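/- Let $\mathbb D=\{z\in\mathbb C:|z|<1\}$. A holomorphic $g:\mathbb D\to\mathbb C$ is called a generator if for every $z\in\mathbb D$ the Cauchy problem $\frac{\partial u}{\partial t}(t,z)+g(u(t,z))=0$, $u(0,z)=z$, has a unique solution $u(t,z)\in\mathbb D$ for all $t\ge 0$; then $\{u(t,\cdot)\}_{t\ge 0}$ is the semigroup generated by $g$. A number $\kappa>0$ is an exponential squeezing coefficient of this semigroup if $|u(t,z)|\le |z|e^{-\kappa t}$ for all $t>0$, $z\in\mathbb D$. Let $q\in\mathbb C$ with $\Re q>0$, let $r\ge 6/\Re q$, and put $$A(s)=\frac{6s(1+s)}{(1+s)^3-3(5s-1)},\qquad \gamma_r=\frac{1-A(r\Re q)}{1+A(r\Re q)}.$$ Let $F:\mathbb D\to\mathbb C$ be holomorphic with $F(0)=0$, $F'(0)=1+rq$ and $\Re\frac1{2r\Re q}\left(\frac{F(z)}z-(1+rq)\right)>-\frac12$, i.e. $\Re\frac{F(z)}z>1$, for $z\in\mathbb D\setminus\{0\}$ (that is, $F=\mathrm{Id}+rf$, where $f(z)=zp(z)$, $\Re p>0$ and $f'(0)=q$), and let $G_r:\mathbb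 D\to\mathbb D$ be holomorphic with $F(G_r(z))=z$ for all $z\in\mathbb D$, i.e. $G_r=(\mathrm{Id}+rf)^{-1}$ is the nonlinear resolvent of $f$. Then $G_r$ is a generator, and the semigroup $\{u(t,\cdot)\}_{t\ge0}$ generated by $G_r$ has the following properties. (i) $u(t,\cdot)$ converges to $0$ as $t\to\infty$, uniformly on $\mathbb D$. If moreover $|\arg(1+rq)|<\frac{\pi\gamma_r}2$, then $$\kappa(r)=\frac{\left(\Re\,(1+rq)^{1/\gamma_r}\right)^{\gamma_r}}{2^{1-\gamma_r}|1+rq|^2}$$ (principal powers) is positive and is an exponential squeezing coefficient of the semigroup. (ii) For every $z\in\mathbb D$, $u(\cdot,z)$ can be analytically extended, with values in $\mathbb D$, to the sector $S=\left\{t\in\mathbb C\setminus\{0\}: |\arg t-\arg(1+rq)|<\frac{\pi\gamma_r}2\right\}$. Precisely, there are an open convex set $W\supset S\cup(0,\infty)$ and a holomorphic map $W\to\mathbb D$ that equals $u(t,z)$ for every $t\in(0,\infty)$. (If $(0,\infty)\subset S$, this says the same with $W=S$.) -/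

import Mathlib

open Complex Set Filter Topology

noncomputable section

/-- The open unit disk. -/
def unitDisk : Set ℂ := Metric.ball (0 : ℂ) 1

/-- The class of holomorphic functions `F` on the unit disk with `F 0 = 0`, `F' 0 = β` and
`Re ((F z / z - β) / α) > -1/2`. At `z = 0` the quotient `F z / z` stands for `F' 0 = β`, where
the inequality is trivial, so it is required at `z ≠ 0` only. -/
def classA (α β : ℂ) : Set (ℂ → ℂ) :=
  {F | DifferentiableOn ℂ F unitDisk ∧ F 0 = 0 ∧ deriv F 0 = β ∧
    ∀ z ∈ unitDisk, z ≠ 0 → -(1 / 2 : ℝ) < ((1 / α) * (F z / z - β)).re}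

/-- The family of resolvents `G = (id + r f)⁻¹`, with `f 0 = 0` and `f' 0 = q`: the holomorphic
self-mappings `G` of the unit disk that are right inverse to some `F = id + r f` in the class
`classA (2 r Re q) (1 + r q)`. -/
def resolventFamily (q : ℂ) (r : ℝ) : Set (ℂ → ℂ) :=
  {G | DifferentiableOn ℂ G unitDisk ∧ MapsTo G unitDisk unitDisk ∧
    ∃ F ∈ classA ((2 * r * q.re : ℝ) : ℂ) (1 + r * q), ∀ z ∈ unitDisk, F (G z) = z}

/-- `v` solves on `[0, ∞)`, inside the unit disk, the Cauchy problem `v' + f(v) = 0`, `v 0 = z`. -/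
def IsFlowLine (f : ℂ → ℂ) (z : ℂ) (v : ℝ → ℂ) : Prop :=
  v 0 = z ∧ ∀ t : ℝ, 0 ≤ t →
    v t ∈ unitDisk ∧ HasDerivWithinAt v (-(f (v t))) (Ici 0) t

/-- `f` is a generator on the unit disk: it is holomorphic there and the Cauchy problem has a unique
solution in the disk for every initial point and all `t ≥ 0`. -/
def IsGenerator (f : ℂ → ℂ) : Prop :=
  DifferentiableOn ℂ f unitDisk ∧
    ∀ z ∈ unitDisk, ∃ v : ℝ → ℂ, IsFlowLine f z v ∧
      ∀ w : ℝ → ℂ, IsFlowLine f z w → EqOn w v (Ici 0)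

/-- `u` is the semigroup generated by `f` (only its values `u t z` for `t ≥ 0` and `z` in the unit
disk matter). -/
def IsSemigroupGeneratedBy (f : ℂ → ℂ) (u : ℝ → ℂ → ℂ) : Prop :=
  ∀ z ∈ unitDisk, IsFlowLine f z (fun t => u t z)

/-- `κ` is an exponential squeezing coefficient of `u`. -/
def IsSqueezingCoefficient (u : ℝ → ℂ → ℂ) (κ : ℝ) : Prop :=
  0 < κ ∧ ∀ t : ℝ, 0 < t → ∀ z ∈ unitDisk, ‖u t z‖ ≤ ‖z‖ * Real.exp (-κ * t)

/-- The open sector of half-opening `δ` around the direction `φ`, without its vertex. -/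
def sector (φ δ : ℝ) : Set ℂ := {t | t ≠ 0 ∧ |arg t - φ| < δ}

/-- The trajectory `v` extends analytically, with values in the unit disk, from the positive half-axis
to `S`. The common domain `W` of the extension makes the notion meaningful also when `S` does not
contain the half-axis. If `S` is open and convex and contains it, this says exactly that some
holomorphic map from `S` to the disk agrees with `v` on the half-axis. -/
def ExtendsAnalyticallyTo (v : ℝ → ℂ) (S : Set ℂ) : Prop :=
  ∃ W : Set ℂ, IsOpen W ∧ Convex ℝ W ∧ S ⊆ W ∧ (∀ t : ℝ, 0 < t → (t : ℂ) ∈ W) ∧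
    ∃ U : ℂ → ℂ, DifferentiableOn ℂ U W ∧ MapsTo U W unitDisk ∧ ∀ t : ℝ, 0 < t → U t = v t

/-- The function `A(s) = 6 s (1 + s) / ((1 + s)³ - 3 (5 s - 1))`. -/
def funA (s : ℝ) : ℝ := 6 * s * (1 + s) / ((1 + s) ^ 3 - 3 * (5 * s - 1))

/-- The number `γ_r = (1 - A(r Re q)) / (1 + A(r Re q))`. -/
def gammaR (q : ℂ) (r : ℝ) : ℝ := (1 - funA (r * q.re)) / (1 + funA (r * q.re))

/-- The number `κ(r) = (Re (1 + r q)^(1/γ_r))^γ_r / (2^(1 - γ_r) |1 + r q|²)`, with principal powers. -/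
def kappaR (q : ℂ) (r : ℝ) : ℝ :=
  (((1 + r * q) ^ (((1 / gammaR q r : ℝ)) : ℂ) : ℂ).re) ^ (gammaR q r) /
    ((2 : ℝ) ^ (1 - gammaR q r) * ‖1 + r * q‖ ^ 2)

end

open scoped NNReal ComplexConjugate

/-! ### Global flows of Lipschitz vector fields -/

/-! Everything follows from the location of `g z = G z / z`. Write `F w = w * Q w` with `Re Q > 1`,
`Q 0 = β = 1 + r q`, and `s = r Re q ≥ 6`. For `w = G z` one has `z = w * Q w`, so `g z = 1 / Q w`.
The Schwarz lemma for `Q - 1` turns this into `β g = (1 - M) / (1 + u M)` with `|M| ≤ |w|` and `|u|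
≤ 1`, while Harnack's inequality and `|w| |Q w| < 1` give `|w| < 1 / (s - 1)`. Taking logarithms, `β
g = exp W` with `|W| ≤ (1 - γ) / 2`, and `Re (1 / g) > 1` gives `|g|² ≤ Re g`
(`resolvent_representation`).

Along the flow `(|v|²)' = -2 Re (g v) |v|²`, so a positive lower bound for `Re g` gives a global
flow and exponential decay. A crude bound suffices for uniform convergence; concavity of the cosine
gives `κ(r)` (`kappaR_le_re`).

For complex time, `u(t, z)` is the time-one value of the flow of `t G`. That flow exists and is
holomorphic in `t` wherever `Re (t g)` is bounded below by a positive constant. Such `t` form an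
open convex set containing the positive axis and, by the bound on `Im W`, the sector. -/

theorem mem_unitDisk {z : ℂ} : z ∈ unitDisk ↔ ‖z‖ < 1 := by
  simp [unitDisk]

/-- A bounded, globally Lipschitz vector field has integral curves on `[0, ∞)`. -/
theorem exists_integralCurve_of_lipschitz {f : ℂ → ℂ} {K : ℝ≥0} (hf : LipschitzWith K f)
    {M : ℝ≥0} (hM : ∀ x, ‖f x‖ ≤ M) (z : ℂ) :
    ∃ v : ℝ → ℂ, v 0 = z ∧ ∀ t : ℝ, 0 ≤ t → HasDerivWithinAt v (f (v t)) (Ici 0) t := by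
  have hex : ∀ n : ℕ, ∃ v : ℝ → ℂ, v 0 = z ∧
      ∀ t ∈ Icc (0 : ℝ) n, HasDerivWithinAt v (f (v t)) (Icc 0 (n : ℝ)) t := by
    intro n
    -- The global bound `M` lets the ball radius `M * n` grow with the interval, so one application
    -- covers all of `[0, n]`.
    have hPL : IsPicardLindelof (fun _ : ℝ => f)
        (⟨0, left_mem_Icc.2 n.cast_nonneg⟩ : Icc (0 : ℝ) n) z (M * n) 0 M K :=
      { lipschitzOnWith := fun _ _ => hf.lipschitzOnWith
        continuousOn := fun _ _ => continuousOn_const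
        norm_le := fun _ _ x _ => hM x
        mul_max_le := by simp }
    exact hPL.exists_eq_forall_mem_Icc_hasDerivWithinAt₀
  choose v hv0 hv using hex
  have right : ∀ n : ℕ, ∀ T ≤ (n : ℝ), ∀ t ∈ Ico (0 : ℝ) T,
      HasDerivWithinAt (v n) (f (v n t)) (Ici t) t := by
    intro n T hT t ht
    have htn : t < n := ht.2.trans_le hT
    refine ((hv n t ⟨ht.1, htn.le⟩).mono_of_mem_nhdsWithin ?_)
    exact mem_of_superset (Icc_mem_nhdsGE htn) (Icc_subset_Icc_left ht.1)
  have agree : ∀ m n : ℕ, ∀ T : ℝ, T ≤ m → T ≤ n → EqOn (v m) (v n) (Icc 0 T) := by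
    intro m n T hm hn
    refine ODE_solution_unique_of_mem_Icc_right (v := fun _ => f) (s := fun _ => univ) (K := K)
      (fun _ _ => hf.lipschitzOnWith) ?_ (right m T hm) (fun _ _ => mem_univ _) ?_ (right n T hn)
      (fun _ _ => mem_univ _) ((hv0 m).trans (hv0 n).symm)
    · exact fun t ht => ((hv m t ⟨ht.1, ht.2.trans hm⟩).continuousWithinAt).mono
        (Icc_subset_Icc_right hm)
    · exact fun t ht => ((hv n t ⟨ht.1, ht.2.trans hn⟩).continuousWithinAt).mono
        (Icc_subset_Icc_right hn)
  refine ⟨fun t => v ⌈t⌉₊ t, by simp [hv0], fun t ht => ?_⟩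
  -- The extra `1` makes `t < n` strict, so that the derivative within `[0, n]` at `t` is one within
  -- `[0, ∞)`.
  set n := ⌈t⌉₊ + 1 with hn
  have htn : t < n := (Nat.le_ceil t).trans_lt (by simp [hn])
  have eq : ∀ x : ℝ, 0 ≤ x → x ≤ n → v ⌈x⌉₊ x = v n x := fun x hx hxn =>
    agree _ _ x (Nat.le_ceil x) hxn ⟨hx, le_rfl⟩
  have h1 : HasDerivWithinAt (v n) (f (v n t)) (Ici 0) t := by
    refine (hv n t ⟨ht, htn.le⟩).mono_of_mem_nhdsWithin ?_
    have : Iic (n : ℝ) ∈ 𝓝[Ici 0] t := mem_nhdsWithin_of_mem_nhds (Iic_mem_nhds htn)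
    filter_upwards [this, self_mem_nhdsWithin] with x hx hx0 using ⟨hx0, hx⟩
  have h2 : (fun t => v ⌈t⌉₊ t) =ᶠ[𝓝[Ici 0] t] v n := by
    have : Iic (n : ℝ) ∈ 𝓝[Ici 0] t := mem_nhdsWithin_of_mem_nhds (Iic_mem_nhds htn)
    filter_upwards [this, self_mem_nhdsWithin] with x hx hx0 using eq x hx0 hx
  have h3 := h1.congr_of_eventuallyEq h2 (eq t ht htn.le)
  simpa only [eq t ht htn.le] using h3

/-- The radial retraction onto the closed disk of radius `R`. -/
noncomputable def radialRetraction (R : ℝ) (z : ℂ) : ℂ := ((R / max R ‖z‖ : ℝ) : ℂ) * z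

theorem radialRetraction_of_norm_le {R : ℝ} (hR : 0 < R) {z : ℂ} (hz : ‖z‖ ≤ R) :
    radialRetraction R z = z := by
  simp [radialRetraction, max_eq_left hz, hR.ne']

theorem norm_radialRetraction_le {R : ℝ} (hR : 0 < R) (z : ℂ) : ‖radialRetraction R z‖ ≤ R := by
  have hm : 0 < max R ‖z‖ := lt_max_of_lt_left hR
  rw [radialRetraction, norm_mul, Complex.norm_real, Real.norm_eq_abs,
    abs_of_pos (div_pos hR hm), div_mul_eq_mul_div, div_le_iff₀ hm]
  exact mul_le_mul_of_nonneg_left (le_max_right _ _) hR.le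

theorem lipschitzWith_radialRetraction {R : ℝ} (hR : 0 < R) :
    LipschitzWith 2 (radialRetraction R) := by
  refine LipschitzWith.of_dist_le_mul fun z w => ?_
  rw [dist_eq_norm, dist_eq_norm]
  have hm : 0 < max R ‖z‖ := lt_max_of_lt_left hR
  have hn : 0 < max R ‖w‖ := lt_max_of_lt_left hR
  set m := max R ‖z‖ with hmdef
  set n := max R ‖w‖ with hndef
  have hmn : |n - m| ≤ ‖z - w‖ := by
    have h := abs_max_sub_max_le_abs ‖w‖ ‖z‖ R
    rw [max_comm _ R, max_comm _ R] at h
    exact h.trans ((abs_norm_sub_norm_le w z).trans (norm_sub_rev w z).le)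
  have key : radialRetraction R z - radialRetraction R w =
      ((R / m : ℝ) : ℂ) * (z - w) + ((R / m * ((n - m) / n) : ℝ) : ℂ) * w := by
    have hmc : (m : ℂ) ≠ 0 := by exact_mod_cast hm.ne'
    have hnc : (n : ℂ) ≠ 0 := by exact_mod_cast hn.ne'
    simp only [radialRetraction, ← hmdef, ← hndef]
    push_cast
    field_simp
    ring
  have h1 : |R / m| ≤ 1 := by
    rw [abs_of_pos (div_pos hR hm), div_le_one hm]
    exact le_max_left _ _
  have h2 : ‖w‖ / n ≤ 1 := (div_le_one hn).2 (le_max_right _ _)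
  rw [key]
  refine (norm_add_le _ _).trans ?_
  rw [norm_mul, norm_mul, Complex.norm_real, Complex.norm_real, Real.norm_eq_abs, Real.norm_eq_abs,
    abs_mul, abs_div (n - m), abs_of_pos hn, mul_assoc, div_mul_eq_mul_div, mul_div_assoc]
  have h3 : |R / m| * ‖z - w‖ ≤ ‖z - w‖ := mul_le_of_le_one_left (norm_nonneg _) h1
  have h4 : |R / m| * (|n - m| * (‖w‖ / n)) ≤ ‖z - w‖ :=
    (mul_le_of_le_one_left (by positivity) h1).trans
      ((mul_le_of_le_one_right (abs_nonneg _) h2).trans hmn)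
  have : ((2 : ℝ≥0) : ℝ) = 2 := rfl
  rw [this]
  linarith

/-- A solution of `v' = -f(v)` decays exponentially if `f` points outward along it. -/
theorem norm_le_mul_exp_of_le_re {f : ℂ → ℂ} {v : ℝ → ℂ} {κ : ℝ}
    (hv : ∀ t : ℝ, 0 ≤ t → HasDerivWithinAt v (-(f (v t))) (Ici 0) t)
    (hκ : ∀ t : ℝ, 0 ≤ t → κ * ‖v t‖ ^ 2 ≤ (conj (v t) * f (v t)).re) {t : ℝ} (ht : 0 ≤ t) :
    ‖v t‖ ≤ ‖v 0‖ * Real.exp (-κ * t) := by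
  have hd : ∀ x : ℝ, 0 ≤ x → HasDerivWithinAt (fun x => Real.exp (2 * κ * x) * ‖v x‖ ^ 2)
      (Real.exp (2 * κ * x) * (2 * κ) * ‖v x‖ ^ 2 +
        Real.exp (2 * κ * x) * (2 * inner ℝ (v x) (-(f (v x))))) (Ici 0) x := by
    intro x hx
    have h1 : HasDerivWithinAt (fun x => Real.exp (2 * κ * x))
        (Real.exp (2 * κ * x) * (2 * κ)) (Ici 0) x := by
      simpa using (((hasDerivAt_id x).const_mul (2 * κ)).exp).hasDerivWithinAt
    exact h1.mul (hv x hx).norm_sq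
  have hanti : AntitoneOn (fun x => Real.exp (2 * κ * x) * ‖v x‖ ^ 2) (Ici 0) := by
    refine antitoneOn_of_hasDerivWithinAt_nonpos (convex_Ici 0)
      (fun x hx => (hd x hx).continuousWithinAt)
      (fun x hx => (hd x (interior_subset hx)).mono interior_subset) fun x hx => ?_
    have hk := hκ x (interior_subset hx)
    rw [Complex.inner, neg_mul, Complex.neg_re]
    rw [mul_comm (conj _)] at hk
    have he := Real.exp_pos (2 * κ * x)
    nlinarith [mul_le_mul_of_nonneg_left hk he.le]
  have h0 := hanti (mem_Ici.2 le_rfl) ht ht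
  simp only [mul_zero, Real.exp_zero, one_mul] at h0
  have he : Real.exp (2 * κ * t) * Real.exp (-κ * t) ^ 2 = 1 := by
    rw [← Real.exp_nat_mul, ← Real.exp_add]
    simp only [Nat.cast_ofNat]
    ring_nf
    simp
  refine le_of_sq_le_sq ?_ (by positivity)
  calc ‖v t‖ ^ 2 = Real.exp (2 * κ * t) * ‖v t‖ ^ 2 * Real.exp (-κ * t) ^ 2 := by
        rw [mul_right_comm, he, one_mul]
    _ ≤ ‖v 0‖ ^ 2 * Real.exp (-κ * t) ^ 2 := mul_le_mul_of_nonneg_right h0 (by positivity)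
    _ = _ := by ring

/-! ### Holomorphic vector fields in the disk -/

theorem closedBall_subset_unitDisk {R : ℝ} (hR : R < 1) : Metric.closedBall (0 : ℂ) R ⊆ unitDisk :=
  Metric.closedBall_subset_ball hR

theorem isOpen_unitDisk : IsOpen unitDisk := Metric.isOpen_ball

theorem exists_lipschitzOnWith_closedBall {f : ℂ → ℂ} (hf : DifferentiableOn ℂ f unitDisk)
    {R : ℝ} (hR : R < 1) : ∃ K : ℝ≥0, LipschitzOnWith K f (Metric.closedBall 0 R) := by
  have hc : ContinuousOn (deriv f) (Metric.closedBall 0 R) :=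
    (hf.deriv isOpen_unitDisk).continuousOn.mono (closedBall_subset_unitDisk hR)
  obtain ⟨C, hC⟩ := (isCompact_closedBall (0 : ℂ) R).exists_bound_of_continuousOn hc
  refine ⟨C.toNNReal, (convex_closedBall (0 : ℂ) R).lipschitzOnWith_of_nnnorm_deriv_le
    (fun x hx => hf.differentiableAt (isOpen_unitDisk.mem_nhds (closedBall_subset_unitDisk hR hx)))
    fun x hx => ?_⟩
  rw [← NNReal.coe_le_coe, coe_nnnorm]
  exact (hC x hx).trans (Real.le_coe_toNNReal C)

/-- Quadratic Taylor bound, uniform on a smaller disk. -/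
theorem exists_taylor_bound {f : ℂ → ℂ} (hf : DifferentiableOn ℂ f unitDisk)
    {R : ℝ} (hR : R < 1) : ∃ C : ℝ, 0 ≤ C ∧ ∀ a ∈ Metric.closedBall (0 : ℂ) R,
      ∀ b ∈ Metric.closedBall (0 : ℂ) R,
        ‖f b - f a - deriv f a * (b - a)‖ ≤ C * ‖b - a‖ ^ 2 := by
  obtain ⟨C, hC⟩ := exists_lipschitzOnWith_closedBall (hf.deriv isOpen_unitDisk) hR
  refine ⟨C, C.2, fun a ha b hb => ?_⟩
  have hseg : segment ℝ a b ⊆ Metric.closedBall 0 R :=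
    (convex_closedBall (0 : ℂ) R).segment_subset ha hb
  have hder : ∀ x ∈ segment ℝ a b, HasDerivWithinAt (fun x => f x - deriv f a * x)
      (deriv f x - deriv f a) (segment ℝ a b) x := by
    intro x hx
    have hx1 : HasDerivAt f (deriv f x) x := (hf.differentiableAt (isOpen_unitDisk.mem_nhds
      (closedBall_subset_unitDisk hR (hseg hx)))).hasDerivAt
    have := (hx1.sub ((hasDerivAt_id x).const_mul (deriv f a))).hasDerivWithinAt
      (s := segment ℝ a b)
    rwa [mul_one] at this
  have hbound : ∀ x ∈ segment ℝ a b, ‖deriv f x - deriv f a‖ ≤ C * ‖b - a‖ := by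
    intro x hx
    have h1 := hC.dist_le_mul x (hseg hx) a ha
    rw [dist_eq_norm, dist_eq_norm] at h1
    refine h1.trans (mul_le_mul_of_nonneg_left ?_ C.2)
    have h2 := norm_sub_le_of_mem_segment hx
    exact h2
  have := (convex_segment a b).norm_image_sub_le_of_norm_hasDerivWithin_le hder hbound
    (left_mem_segment ℝ a b) (right_mem_segment ℝ a b)
  calc ‖f b - f a - deriv f a * (b - a)‖
      = ‖f b - deriv f a * b - (f a - deriv f a * a)‖ := by congr 1; ring
    _ ≤ C * ‖b - a‖ * ‖b - a‖ := this
    _ = _ := by ring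

theorem IsFlowLine.continuousOn {f : ℂ → ℂ} {z : ℂ} {v : ℝ → ℂ} (hv : IsFlowLine f z v) :
    ContinuousOn v (Ici 0) :=
  fun t ht => (hv.2 t ht).2.continuousWithinAt

/-- `f` is Lipschitz only on smaller closed disks, but by compactness both trajectories stay in one
of them up to time `T`. -/
theorem IsFlowLine.eqOn {f : ℂ → ℂ} (hf : DifferentiableOn ℂ f unitDisk) {z : ℂ} {v w : ℝ → ℂ}
    (hv : IsFlowLine f z v) (hw : IsFlowLine f z w) : EqOn v w (Ici 0) := by
  intro T hT
  have hcv := hv.continuousOn.mono (Icc_subset_Ici_self : Icc 0 T ⊆ _)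
  have hcw := hw.continuousOn.mono (Icc_subset_Ici_self : Icc 0 T ⊆ _)
  have hne : (Icc (0 : ℝ) T).Nonempty := ⟨0, left_mem_Icc.2 hT⟩
  obtain ⟨a, ha, hav⟩ := isCompact_Icc.exists_isMaxOn hne hcv.norm
  obtain ⟨b, hb, hbw⟩ := isCompact_Icc.exists_isMaxOn hne hcw.norm
  set R := max ‖v a‖ ‖w b‖ with hR
  have hR1 : R < 1 := max_lt (mem_unitDisk.1 (hv.2 a ha.1).1) (mem_unitDisk.1 (hw.2 b hb.1).1)
  obtain ⟨K, hK⟩ := exists_lipschitzOnWith_closedBall hf.neg hR1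
  refine ODE_solution_unique_of_mem_Icc_right (v := fun _ x => -(f x))
    (s := fun _ => Metric.closedBall 0 R) (K := K) (fun _ _ => hK) hcv
    (fun t ht => (hv.2 t ht.1).2.mono (Ici_subset_Ici.2 ht.1)) (fun t ht => ?_) hcw
    (fun t ht => (hw.2 t ht.1).2.mono (Ici_subset_Ici.2 ht.1)) (fun t ht => ?_)
    (hv.1.trans hw.1.symm) (right_mem_Icc.2 hT)
  · exact mem_closedBall_zero_iff.2 ((hav (Ico_subset_Icc_self ht)).trans (le_max_left _ _))
  · exact mem_closedBall_zero_iff.2 ((hbw (Ico_subset_Icc_self ht)).trans (le_max_right _ _))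

theorem IsFlowLine.norm_le {f : ℂ → ℂ} {z : ℂ} {v : ℝ → ℂ} (hv : IsFlowLine f z v) {κ : ℝ}
    (hκ : ∀ w ∈ unitDisk, κ * ‖w‖ ^ 2 ≤ (conj w * f w).re) {t : ℝ} (ht : 0 ≤ t) :
    ‖v t‖ ≤ ‖z‖ * Real.exp (-κ * t) := by
  rw [← hv.1]
  exact norm_le_mul_exp_of_le_re (fun t ht => (hv.2 t ht).2) (fun t ht => hκ _ (hv.2 t ht).1) ht

/-- Composing `f` with the radial retraction gives a bounded Lipschitz field. The retraction
multiplies by a positive real, so the sign condition survives, `|v|` never increases, and the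
trajectory never meets the region where the field was changed. -/
theorem exists_isFlowLine {f : ℂ → ℂ} (hf : DifferentiableOn ℂ f unitDisk)
    (hre : ∀ w ∈ unitDisk, 0 ≤ (conj w * f w).re) {z : ℂ} (hz : z ∈ unitDisk) :
    ∃ v, IsFlowLine f z v := by
  rw [mem_unitDisk] at hz
  obtain ⟨R, hzR, hR1⟩ := exists_between hz
  have hR0 : 0 < R := (norm_nonneg z).trans_lt hzR
  obtain ⟨K, hK⟩ := exists_lipschitzOnWith_closedBall hf.neg hR1
  obtain ⟨M, hM⟩ := (isCompact_closedBall (0 : ℂ) R).exists_bound_of_continuousOn hK.continuousOn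
  have hmaps : ∀ x, radialRetraction R x ∈ Metric.closedBall (0 : ℂ) R := fun x =>
    mem_closedBall_zero_iff.2 (norm_radialRetraction_le hR0 x)
  have hlip : LipschitzWith (K * 2) (fun x => -(f (radialRetraction R x))) :=
    lipschitzOnWith_univ.1 (hK.comp (lipschitzWith_radialRetraction hR0).lipschitzOnWith
      fun x _ => hmaps x)
  obtain ⟨v, hv0, hv⟩ := exists_integralCurve_of_lipschitz hlip (M := M.toNNReal)
    (fun x => (hM _ (hmaps x)).trans (Real.le_coe_toNNReal M)) z
  have hnorm : ∀ t, 0 ≤ t → ‖v t‖ ≤ R := by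
    intro t ht
    have := norm_le_mul_exp_of_le_re (f := fun x => f (radialRetraction R x)) (κ := 0) hv
      (fun t _ => ?_) ht
    · rw [hv0] at this
      simpa using this.trans (by simpa using hzR.le)
    · have h1 := hre _ (closedBall_subset_unitDisk hR1 (hmaps (v t)))
      have hm : 0 < R / max R ‖v t‖ := div_pos hR0 (lt_max_of_lt_left hR0)
      nth_rewrite 1 [radialRetraction] at h1
      rw [map_mul, Complex.conj_ofReal, mul_assoc, Complex.re_ofReal_mul] at h1
      simpa using nonneg_of_mul_nonneg_right h1 hm
  refine ⟨v, hv0, fun t ht => ⟨mem_unitDisk.2 ((hnorm t ht).trans_lt hR1), ?_⟩⟩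
  simpa only [radialRetraction_of_norm_le hR0 (hnorm t ht)] using hv t ht

/-- The time-one map of the flow of `t * f` is holomorphic in the complex parameter `t`. -/
theorem hasDerivAt_flow_of_parameter {f : ℂ → ℂ} (hf : DifferentiableOn ℂ f unitDisk) {z : ℂ}
    (hz : z ∈ unitDisk) {v : ℂ → ℝ → ℂ} {t₀ : ℂ}
    (hv : ∀ᶠ t in 𝓝 t₀, IsFlowLine (fun w => t * f w) z (v t) ∧
      ∀ σ : ℝ, 0 ≤ σ → ‖v t σ‖ ≤ ‖z‖) :
    HasDerivAt (fun t => v t 1) (-(f (v t₀ 1))) t₀ := by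
  rw [mem_unitDisk] at hz
  obtain ⟨R, hzR, hR1⟩ := exists_between hz
  have hsub := closedBall_subset_unitDisk hR1
  obtain ⟨K, hK⟩ := exists_lipschitzOnWith_closedBall hf hR1
  obtain ⟨C, hC0, hC⟩ := exists_taylor_bound hf hR1
  obtain ⟨B, hB⟩ := (isCompact_closedBall (0 : ℂ) R).exists_bound_of_continuousOn hK.continuousOn
  obtain ⟨B', hB'⟩ := (isCompact_closedBall (0 : ℂ) R).exists_bound_of_continuousOn
    ((hf.deriv isOpen_unitDisk).continuousOn.mono hsub)
  have hzmem : z ∈ Metric.closedBall (0 : ℂ) R := mem_closedBall_zero_iff.2 hzR.le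
  have hB0 : 0 ≤ B := (norm_nonneg _).trans (hB z hzmem)
  have hB'0 : 0 ≤ B' := (norm_nonneg _).trans (hB' z hzmem)
  obtain ⟨hv₀, hv₀z⟩ := hv.self_of_nhds
  set L : ℝ≥0 := (‖t₀‖₊ + 1) * K + 1 with hL
  have hL0 : (L : ℝ) ≠ 0 := by positivity
  set E : ℝ := B' * B + (‖t₀‖ + 1) * (C * B ^ 2) with hE
  have hsmall : ∀ᶠ t in 𝓝 t₀, ‖t - t₀‖ < 1 ∧ ‖t - t₀‖ * B < R - ‖z‖ := by
    have h1 : Tendsto (fun t => ‖t - t₀‖) (𝓝 t₀) (𝓝 0) := by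
      simpa using ((tendsto_id (x := 𝓝 t₀)).sub_const t₀).norm
    have h2 : Tendsto (fun t => ‖t - t₀‖ * B) (𝓝 t₀) (𝓝 0) := by
      simpa using h1.mul_const B
    exact (h1.eventually_lt_const one_pos).and (h2.eventually_lt_const (sub_pos.2 hzR))
  rw [hasDerivAt_iff_isLittleO]
  refine Asymptotics.IsBigO.trans_isLittleO (g := fun t => ‖t - t₀‖ ^ 2) ?_
    (Asymptotics.isLittleO_pow_sub_sub t₀ one_lt_two)
  refine Asymptotics.IsBigO.of_bound (E / L * (Real.exp L - 1)) ?_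
  filter_upwards [hv, hsmall] with t ht hts
  obtain ⟨htv, htz⟩ := ht
  set h := t - t₀ with hh
  have htn : ‖t‖ ≤ ‖t₀‖ + 1 := by
    calc ‖t‖ = ‖t₀ + h‖ := by rw [hh]; ring_nf
      _ ≤ _ := (norm_add_le _ _).trans (by linarith [hts.1])
  have mem₀ : ∀ σ, 0 ≤ σ → v t₀ σ ∈ Metric.closedBall (0 : ℂ) R := fun σ hσ =>
    mem_closedBall_zero_iff.2 ((hv₀z σ hσ).trans hzR.le)
  -- Heuristically `v t σ = u (t σ)`, and `w` is its first-order expansion in `h`. It solves the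
  -- equation for `t` up to an error `O(|h|²)`, so Grönwall gives `v t 1 = w 1 + O(|h|²)`.
  set w : ℝ → ℂ := fun σ => v t₀ σ - h * σ * f (v t₀ σ) with hw
  have memw : ∀ σ ∈ Ico (0 : ℝ) 1, w σ ∈ Metric.closedBall (0 : ℂ) R := by
    intro σ hσ
    rw [mem_closedBall_zero_iff]
    have h1 : ‖h * σ * f (v t₀ σ)‖ ≤ ‖h‖ * B := by
      rw [norm_mul, norm_mul, Complex.norm_real, Real.norm_eq_abs, abs_of_nonneg hσ.1]
      exact mul_le_mul (mul_le_of_le_one_right (norm_nonneg _) hσ.2.le) (hB _ (mem₀ σ hσ.1))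
        (norm_nonneg _) (norm_nonneg _)
    calc ‖w σ‖ ≤ ‖v t₀ σ‖ + ‖h * σ * f (v t₀ σ)‖ := norm_sub_le _ _
      _ ≤ R := by linarith [hv₀z σ hσ.1, hts.2]
  have hw' : ∀ σ : ℝ, 0 ≤ σ → HasDerivWithinAt w (-(t₀ * f (v t₀ σ)) -
      (h * f (v t₀ σ) + h * σ * (deriv f (v t₀ σ) * -(t₀ * f (v t₀ σ))))) (Ici 0) σ := by
    intro σ hσ
    have h1 : HasDerivWithinAt (fun σ : ℝ => h * (σ : ℂ)) h (Ici 0) σ := by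
      simpa using ((Complex.ofRealCLM.hasDerivAt (x := σ)).const_mul h).hasDerivWithinAt
    have h2 : HasDerivAt f (deriv f (v t₀ σ)) (v t₀ σ) := (hf.differentiableAt
      (isOpen_unitDisk.mem_nhds (hsub (mem₀ σ hσ)))).hasDerivAt
    exact (hv₀.2 σ hσ).2.sub (h1.mul (h2.comp_hasDerivWithinAt σ (hv₀.2 σ hσ).2))
  have hdefect : ∀ σ ∈ Ico (0 : ℝ) 1, dist (-(t₀ * f (v t₀ σ)) -
      (h * f (v t₀ σ) + h * σ * (deriv f (v t₀ σ) * -(t₀ * f (v t₀ σ)))))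
      (-(t * f (w σ))) ≤ ‖h‖ ^ 2 * E := by
    intro σ hσ
    have hT := hC _ (mem₀ σ hσ.1) _ (memw σ hσ)
    have hfb := hB _ (mem₀ σ hσ.1)
    have hfb' := hB' _ (mem₀ σ hσ.1)
    have hdiff : w σ - v t₀ σ = -(h * σ * f (v t₀ σ)) := by simp [hw]
    rw [hdiff] at hT
    set e := f (w σ) - f (v t₀ σ) - deriv f (v t₀ σ) * -(h * σ * f (v t₀ σ)) with he
    have hσ1 : ‖(σ : ℂ)‖ ≤ 1 := by
      rw [Complex.norm_real, Real.norm_eq_abs, abs_of_nonneg hσ.1]; exact hσ.2.le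
    have hd1 : ‖h * σ * f (v t₀ σ)‖ ≤ ‖h‖ * B := by
      rw [norm_mul, norm_mul]
      exact mul_le_mul (mul_le_of_le_one_right (norm_nonneg _) hσ1) hfb
        (norm_nonneg _) (norm_nonneg _)
    have he1 : ‖e‖ ≤ C * (‖h‖ * B) ^ 2 := by
      refine hT.trans (mul_le_mul_of_nonneg_left ?_ hC0)
      rw [norm_neg]
      exact pow_le_pow_left₀ (norm_nonneg _) hd1 2
    have heq : -(t₀ * f (v t₀ σ)) -
        (h * f (v t₀ σ) + h * σ * (deriv f (v t₀ σ) * -(t₀ * f (v t₀ σ)))) - -(t * f (w σ)) =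
        t * e - h * (deriv f (v t₀ σ) * (h * σ * f (v t₀ σ))) := by
      rw [he, hh]; ring
    rw [dist_eq_norm, heq]
    calc _ ≤ ‖t * e‖ + ‖h * (deriv f (v t₀ σ) * (h * σ * f (v t₀ σ)))‖ := norm_sub_le _ _
      _ = ‖t‖ * ‖e‖ + ‖h‖ * (‖deriv f (v t₀ σ)‖ * ‖h * σ * f (v t₀ σ)‖) := by
        rw [norm_mul, norm_mul h, norm_mul (deriv f _)]
      _ ≤ (‖t₀‖ + 1) * (C * (‖h‖ * B) ^ 2) + ‖h‖ * (B' * (‖h‖ * B)) := by gcongr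
      _ = ‖h‖ ^ 2 * E := by rw [hE]; ring
  have hlip : LipschitzOnWith L (fun x => -(t * f x)) (Metric.closedBall 0 R) := by
    refine LipschitzOnWith.of_dist_le_mul fun x hx y hy => ?_
    have hxy := hK.dist_le_mul x hx y hy
    rw [dist_neg_neg, dist_eq_norm, ← mul_sub, norm_mul, ← dist_eq_norm]
    calc ‖t‖ * dist (f x) (f y) ≤ (‖t₀‖ + 1) * (K * dist x y) := by gcongr
      _ ≤ L * dist x y := by
        rw [hL]; push_cast
        nlinarith [dist_nonneg (x := x) (y := y)]
  have hG := dist_le_of_approx_trajectories_ODE_of_mem (v := fun _ x => -(t * f x))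
    (s := fun _ => Metric.closedBall 0 R) (K := L) (a := 0) (b := 1) (f := w) (g := v t)
    (δ := 0) (εg := 0) (fun _ _ => hlip)
    (fun σ hσ => ((hw' σ hσ.1).continuousWithinAt).mono Icc_subset_Ici_self)
    (fun σ hσ => (hw' σ hσ.1).mono (Ici_subset_Ici.2 hσ.1)) hdefect memw
    (htv.continuousOn.mono Icc_subset_Ici_self)
    (fun σ hσ => (htv.2 σ hσ.1).2.mono (Ici_subset_Ici.2 hσ.1))
    (fun σ _ => by simp)
    (fun σ hσ => mem_closedBall_zero_iff.2 ((htz σ hσ.1).trans hzR.le))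
    (by simp [hw, hv₀.1, htv.1]) 1 (right_mem_Icc.2 zero_le_one)
  rw [gronwallBound_of_K_ne_0 hL0, dist_comm, dist_eq_norm] at hG
  simp only [zero_mul, add_zero, zero_add, sub_zero, mul_one] at hG
  calc ‖v t 1 - v t₀ 1 - h • -f (v t₀ 1)‖ = ‖v t 1 - w 1‖ := by
        congr 1; simp [hw]; ring
    _ ≤ _ := hG
    _ = _ := by rw [norm_pow, norm_norm]; ring

/-! ### Functions with positive real part -/

/-- The squares differ by `4 Re a Re b`. -/
theorem norm_sub_le_norm_add_conj {a b : ℂ} (ha : 0 ≤ a.re) (hb : 0 ≤ b.re) :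
    ‖a - b‖ ≤ ‖a + conj b‖ := by
  refine le_of_sq_le_sq ?_ (norm_nonneg _)
  rw [Complex.sq_norm, Complex.sq_norm, normSq_apply, normSq_apply]
  simp only [sub_re, sub_im, add_re, add_im, conj_re, conj_im]
  nlinarith [mul_nonneg ha hb]

/-- Schwarz lemma for holomorphic maps from the disk to the right half-plane. -/
theorem norm_sub_le_of_re_pos {P : ℂ → ℂ} (hP : DifferentiableOn ℂ P unitDisk)
    (hre : ∀ w ∈ unitDisk, 0 < (P w).re) {w : ℂ} (hw : w ∈ unitDisk) :
    ‖(P w - P 0) / (P w + conj (P 0))‖ ≤ ‖w‖ := by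
  have h0 : 0 < (P 0).re := hre 0 (mem_unitDisk.2 (by simp))
  have hne : ∀ x ∈ unitDisk, P x + conj (P 0) ≠ 0 := by
    intro x hx h
    have := congrArg Complex.re h
    simp only [add_re, conj_re, zero_re] at this
    linarith [hre x hx]
  refine norm_le_norm_of_mapsTo_ball (f := fun w => (P w - P 0) / (P w + conj (P 0))) (R := 1)
    ((hP.sub_const _).div (hP.add_const _) hne) ?_ (by simp) (mem_unitDisk.1 hw)
  intro x hx
  rw [mem_closedBall_zero_iff, norm_div]
  exact div_le_one_of_le₀ (norm_sub_le_norm_add_conj (hre x hx).le h0.le) (norm_nonneg _)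

/-- Harnack's inequality, as a pointwise consequence of the Schwarz lemma. -/
theorem re_mul_le_of_norm_sub_le {a b : ℂ} {x : ℝ} (ha : 0 < a.re) (hb : 0 < b.re) (hx : x ≤ 1)
    (hx0 : 0 ≤ x) (h : ‖a - b‖ ≤ x * ‖a + conj b‖) : b.re * (1 - x) ≤ a.re * (1 + x) := by
  have h2 := pow_le_pow_left₀ (norm_nonneg _) h 2
  rw [mul_pow, Complex.sq_norm, Complex.sq_norm, normSq_apply, normSq_apply] at h2
  simp only [sub_re, sub_im, add_re, add_im, conj_re, conj_im] at h2
  have hx2 : x ^ 2 ≤ 1 := pow_le_one₀ hx0 hx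
  have h3 : (b.re - a.re) ^ 2 ≤ (x * (a.re + b.re)) ^ 2 := by
    nlinarith [mul_nonneg (sub_nonneg.2 hx2) (mul_self_nonneg (a.im - b.im))]
  have := abs_le_of_sq_le_sq h3 (by positivity)
  linarith [(abs_le.1 this).2]

/-! ### Numerical facts about `gammaR` -/

theorem gammaR_bounds {q : ℂ} {r : ℝ} (hs : 6 ≤ r * q.re) :
    0 < gammaR q r ∧ gammaR q r < 1 ∧ 1 - gammaR q r =
      12 * (r * q.re) * (1 + r * q.re) /
        ((r * q.re) ^ 3 + 9 * (r * q.re) ^ 2 - 6 * (r * q.re) + 4) := by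
  unfold gammaR
  set s := r * q.re
  have hD : 0 < (1 + s) ^ 3 - 3 * (5 * s - 1) := by nlinarith [mul_nonneg (by linarith : 0 ≤ s) (sq_nonneg s)]
  have hA0 : 0 < funA s := by unfold funA; positivity
  have hA1 : funA s < 1 := by
    unfold funA
    rw [div_lt_one hD]
    -- The claim is `s (s - 6) (s + 3) + 4 > 0`, whence the threshold `6`.
    nlinarith [mul_nonneg (sub_nonneg.2 hs) (sq_nonneg s), mul_nonneg (sub_nonneg.2 hs) (sub_nonneg.2 hs)]
  have hE : 0 < s ^ 3 + 9 * s ^ 2 - 6 * s + 4 := by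
    nlinarith [mul_nonneg (by linarith : 0 ≤ s) (sq_nonneg s)]
  refine ⟨div_pos (by linarith) (by linarith), (div_lt_one (by linarith)).2 (by linarith), ?_⟩
  have h1 : 1 - (1 - funA s) / (1 + funA s) = 2 * funA s / (1 + funA s) := by
    field_simp
    ring
  have h2 : funA s * ((1 + s) ^ 3 - 3 * (5 * s - 1)) = 6 * s * (1 + s) := by
    exact div_mul_cancel₀ _ hD.ne'
  rw [h1, div_eq_div_iff (by linarith) hE.ne']
  linear_combination 2 * h2

/-- The left side increases in `x`, so `x = 1 / (s - 1)` is the worst case. The resulting polynomial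
inequality has nonnegative coefficients in powers of `s - 6`. -/
theorem log_bound_le_gammaR {q : ℂ} {r : ℝ} (hs : 6 ≤ r * q.re) {x : ℝ} (hx0 : 0 ≤ x)
    (hx : x * (r * q.re - 1) < 1) :
    2 * (x ^ 2 * (1 - x)⁻¹ / 2 + x) ≤ (1 - gammaR q r) / 2 := by
  rw [(gammaR_bounds hs).2.2]
  set s := r * q.re
  have hE : 0 < s ^ 3 + 9 * s ^ 2 - 6 * s + 4 := by
    nlinarith [mul_nonneg (by linarith : 0 ≤ s) (sq_nonneg s)]
  have h1 : 0 < s - 1 := by linarith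
  have h2 : 0 < s - 2 := by linarith
  have hxb : x ≤ 1 / (s - 1) := ((lt_div_iff₀ h1).2 hx).le
  have hb : 1 - 1 / (s - 1) = (s - 2) / (s - 1) := by field_simp; ring
  have hb0 : 0 < 1 - 1 / (s - 1) := by rw [hb]; positivity
  have hx1 : 0 ≤ (1 - x)⁻¹ := inv_nonneg.2 (by linarith)
  calc 2 * (x ^ 2 * (1 - x)⁻¹ / 2 + x)
      ≤ 2 * ((1 / (s - 1)) ^ 2 * (1 - 1 / (s - 1))⁻¹ / 2 + 1 / (s - 1)) := by gcongr
    _ = (2 * s - 3) / ((s - 1) * (s - 2)) := by rw [hb]; field_simp; ring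
    _ ≤ _ := by
      rw [div_div, div_le_div_iff₀ (by positivity) (by positivity)]
      have : 0 ≤ s - 6 := by linarith
      have e : 12 * s * (1 + s) * ((s - 1) * (s - 2)) -
          (2 * s - 3) * ((s ^ 3 + 9 * s ^ 2 - 6 * s + 4) * 2) =
          2 * (4 * (s - 6) ^ 4 + 69 * (s - 6) ^ 3 + 411 * (s - 6) ^ 2 + 922 * (s - 6) + 468) := by
        ring
      have : 0 ≤ 12 * s * (1 + s) * ((s - 1) * (s - 2)) -
          (2 * s - 3) * ((s ^ 3 + 9 * s ^ 2 - 6 * s + 4) * 2) := by rw [e]; positivity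
      linarith

/-! ### The quotient `G z / z` of a resolvent -/

theorem norm_log_sub_log_le {M u : ℂ} (hM : ‖M‖ < 1) (hu : ‖u‖ ≤ 1) :
    ‖log (1 - M) - log (1 + u * M)‖ ≤ 2 * (‖M‖ ^ 2 * (1 - ‖M‖)⁻¹ / 2 + ‖M‖) := by
  have huM : ‖u * M‖ ≤ ‖M‖ := by
    rw [norm_mul]; exact mul_le_of_le_one_left (norm_nonneg _) hu
  have h1 : ‖log (1 - M)‖ ≤ ‖M‖ ^ 2 * (1 - ‖M‖)⁻¹ / 2 + ‖M‖ := by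
    have := norm_log_one_add_le (z := -M) (by rwa [norm_neg])
    rwa [norm_neg, ← sub_eq_add_neg] at this
  have h2 : ‖log (1 + u * M)‖ ≤ ‖M‖ ^ 2 * (1 - ‖M‖)⁻¹ / 2 + ‖M‖ := by
    refine (norm_log_one_add_le (huM.trans_lt hM)).trans ?_
    have : 0 < 1 - ‖M‖ := by linarith
    have : 0 ≤ (1 - ‖u * M‖)⁻¹ := inv_nonneg.2 (by linarith)
    gcongr
  exact (norm_sub_le _ _).trans (by linarith)

theorem one_add_ne_zero_of_norm_lt_one {a : ℂ} (ha : ‖a‖ < 1) : 1 + a ≠ 0 := by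
  intro h
  rw [← norm_neg, ← eq_neg_iff_add_eq_zero.2 h, norm_one] at ha
  exact ha.false

/-- A resolvent `G` satisfies `G z = z * g z`, where `(1 + r q) * g z` is the exponential of a
number of modulus at most `(1 - γ_r) / 2`, and `g z` lies in the disk with diameter `[0, 1]`. -/
theorem resolvent_representation {q : ℂ} {r : ℝ} (hs : 6 ≤ r * q.re) {G : ℂ → ℂ}
    (hG : G ∈ resolventFamily q r) {z : ℂ} (hz : z ∈ unitDisk) :
    ∃ W : ℂ, ‖W‖ ≤ (1 - gammaR q r) / 2 ∧ G z = z * (exp W / (1 + r * q)) ∧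
      ‖exp W / (1 + r * q)‖ ^ 2 ≤ (exp W / (1 + r * q)).re := by
  obtain ⟨-, hGD, F, ⟨hF, hF0, hF', hFre⟩, hFG⟩ := hG
  set s := r * q.re with hsdef
  set β : ℂ := 1 + r * q with hβ
  have hβre : β.re = 1 + s := by simp [hβ, hsdef]
  have h0D : (0 : ℂ) ∈ unitDisk := mem_unitDisk.2 (by simp)
  set Q := dslope F 0 with hQ
  have hQ0 : Q 0 = β := by rw [hQ, dslope_same, hF']
  have hQd : DifferentiableOn ℂ Q unitDisk :=
    (differentiableOn_dslope (isOpen_unitDisk.mem_nhds h0D)).2 hF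
  have hFQ : ∀ w, F w = w * Q w := by
    intro w
    have := sub_smul_dslope F 0 w
    rw [hF0, sub_zero, sub_zero, smul_eq_mul] at this
    exact this.symm
  have hQre : ∀ w ∈ unitDisk, 1 < (Q w).re := by
    intro w hw
    rcases eq_or_ne w 0 with rfl | hw0
    · rw [hQ0, hβre]; linarith
    · have h1 := hFre w hw hw0
      have h3 : 1 / ((2 * r * q.re : ℝ) : ℂ) = (((2 * s)⁻¹ : ℝ) : ℂ) := by
        rw [one_div, ← Complex.ofReal_inv, hsdef, mul_assoc]
      rw [hFQ w, mul_div_cancel_left₀ _ hw0, h3, Complex.re_ofReal_mul, sub_re, hβre] at h1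
      have h2 : (2 * s)⁻¹ * ((Q w).re - (1 + s)) = ((Q w).re - (1 + s)) / (2 * s) := by ring
      rw [h2, lt_div_iff₀ (by linarith)] at h1
      linarith
  set w := G z with hw
  have hwD : w ∈ unitDisk := hGD hz
  have hzw : z = w * Q w := by rw [← hFQ, hw, hFG z hz]
  have hPre : ∀ x ∈ unitDisk, 0 < (Q x - 1).re := fun x hx => by
    rw [sub_re, one_re]; linarith [hQre x hx]
  have hsch := norm_sub_le_of_re_pos (P := fun x => Q x - 1) (hQd.sub_const 1) hPre hwD
  simp only [hQ0] at hsch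
  set a := Q w - 1 with ha
  set b := β - 1 with hb
  have hbre : b.re = s := by rw [hb, sub_re, hβre]; simp
  have hare : 0 < a.re := hPre w hwD
  have hab : a + conj b ≠ 0 := by
    intro h
    have := congrArg Complex.re h
    simp only [add_re, conj_re, zero_re] at this
    linarith
  set M := (a - b) / (a + conj b) with hM
  set x := ‖w‖ with hx
  have hx0 : 0 ≤ x := norm_nonneg w
  have hx1 : x < 1 := mem_unitDisk.1 hwD
  have hharn : s * (1 - x) ≤ a.re * (1 + x) := by
    rw [← hbre]
    refine re_mul_le_of_norm_sub_le hare (by linarith) hx1.le hx0 ?_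
    rwa [hM, norm_div, div_le_iff₀ (norm_pos_iff.2 hab)] at hsch
  -- Multiplying `x (1 + Re a) < 1` by `1 + x` and inserting Harnack gives `s x (1 - x) < (1 + x) (1
  -- - x)`.
  have hxs : x * (s - 1) < 1 := by
    have h1 : x * (1 + a.re) < 1 := by
      have h2 : 1 + a.re ≤ ‖Q w‖ := by
        have := re_le_norm (Q w)
        rw [ha, sub_re, one_re]; linarith
      calc x * (1 + a.re) ≤ x * ‖Q w‖ := mul_le_mul_of_nonneg_left h2 hx0
        _ = ‖z‖ := by rw [hzw, norm_mul]
        _ < 1 := mem_unitDisk.1 hz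
    have h3 := mul_le_mul_of_nonneg_left hharn hx0
    nlinarith
  have hMx : ‖M‖ ≤ x := hsch
  have hβ0 : β ≠ 0 := by
    intro h
    rw [h, zero_re] at hβre
    linarith
  set u := (conj β - 2) / β with hu
  -- `|β|² - |conj β - 2|² = 4 (Re β - 1) = 4 s`.
  have hu1 : ‖u‖ ≤ 1 := by
    rw [hu, norm_div]
    refine div_le_one_of_le₀ (le_of_sq_le_sq ?_ (norm_nonneg _)) (norm_nonneg _)
    rw [Complex.sq_norm, Complex.sq_norm, normSq_apply, normSq_apply]
    simp only [sub_re, sub_im, conj_re, conj_im, re_ofNat, im_ofNat]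
    nlinarith
  have huM : ‖u * M‖ < 1 := by
    rw [norm_mul]
    exact (mul_le_of_le_one_left (norm_nonneg _) hu1).trans_lt (hMx.trans_lt hx1)
  have hne1 : 1 - M ≠ 0 := by
    rw [sub_eq_add_neg]
    exact one_add_ne_zero_of_norm_lt_one (by rw [norm_neg]; exact hMx.trans_lt hx1)
  have hne2 : 1 + u * M ≠ 0 := one_add_ne_zero_of_norm_lt_one huM
  -- This is the Cayley transform defining `M`, solved for `Q w = 1 + a`.
  have hQM : Q w * (1 - M) = β * (1 + u * M) := by
    have h1 : M * (a + conj b) = a - b := div_mul_cancel₀ _ hab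
    have h2 : conj b = conj β - 1 := by rw [hb, map_sub, map_one]
    have h3 : β * u = conj β - 2 := mul_div_cancel₀ _ hβ0
    rw [h2] at h1
    linear_combination -h1 - M * h3
  have hQ0' : Q w ≠ 0 := by
    intro h
    have := hQre w hwD
    rw [h, zero_re] at this
    linarith
  have hexp : exp (log (1 - M) - log (1 + u * M)) / β = (Q w)⁻¹ := by
    rw [exp_sub, exp_log hne1, exp_log hne2, div_div, inv_eq_one_div,
      div_eq_div_iff (mul_ne_zero hne2 hβ0) hQ0']
    linear_combination hQM
  refine ⟨log (1 - M) - log (1 + u * M), ?_, ?_, ?_⟩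
  · refine (norm_log_sub_log_le (hMx.trans_lt hx1) hu1).trans
      (log_bound_le_gammaR hs (norm_nonneg M) ?_)
    exact (mul_le_mul_of_nonneg_right hMx (by linarith)).trans_lt hxs
  · rw [hexp, hzw, mul_assoc, mul_inv_cancel₀ hQ0', mul_one]
  · rw [hexp, inv_re, norm_inv, inv_pow, Complex.sq_norm, inv_eq_one_div]
    exact div_le_div_of_nonneg_right (hQre w hwD).le (normSq_nonneg _)

/-! ### Lower bounds for the real part of `t * exp W / β` -/

/-- Weighted AM-GM followed by concavity of the cosine. -/
theorem cos_rpow_mul_cos_rpow_le {a b γ : ℝ} (hγ0 : 0 ≤ γ) (hγ1 : γ ≤ 1)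
    (ha : |a| ≤ Real.pi / 2) (hb : |b| ≤ Real.pi / 2) :
    Real.cos a ^ γ * Real.cos b ^ (1 - γ) ≤ Real.cos (γ * a + (1 - γ) * b) := by
  have ha' := abs_le.1 ha
  have hb' := abs_le.1 hb
  refine (Real.geom_mean_le_arith_mean2_weighted hγ0 (sub_nonneg.2 hγ1)
    (Real.cos_nonneg_of_mem_Icc ha') (Real.cos_nonneg_of_mem_Icc hb') (by ring)).trans ?_
  exact strictConcaveOn_cos_Icc.concaveOn.2 ha' hb' hγ0 (sub_nonneg.2 hγ1) (by ring)

/-- Source of the factor `2 ^ (1 - γ)` in `κ(r)`; the tangent line of `exp` and the quadratic bound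
for `cos` suffice. -/
theorem half_le_exp_re_mul_cos_im {W : ℂ} (hW : ‖W‖ ≤ 1 / 2) :
    1 / 2 ≤ Real.exp W.re * Real.cos W.im := by
  have h1 : W.re ^ 2 + W.im ^ 2 ≤ 1 / 4 := by
    have := pow_le_pow_left₀ (norm_nonneg _) hW 2
    rw [Complex.sq_norm, normSq_apply] at this
    nlinarith
  have hre : -(1 / 2) ≤ W.re := by nlinarith [sq_nonneg W.im]
  have h2 : 1 + W.re ≤ Real.exp W.re := by linarith [Real.add_one_le_exp W.re]
  have h3 := Real.one_sub_sq_div_two_le_cos (x := W.im)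
  have h4 : 0 ≤ 1 - W.im ^ 2 / 2 := by nlinarith [sq_nonneg W.re]
  calc (1 / 2 : ℝ) ≤ (1 + W.re) * (1 - W.im ^ 2 / 2) := by
        nlinarith [mul_nonneg (by linarith : 0 ≤ 1 + W.re) (sub_nonneg.2 h1),
          mul_nonneg (by linarith : 0 ≤ W.re + 1 / 2) (sq_nonneg W.re)]
    _ ≤ _ := mul_le_mul h2 h3 h4 (Real.exp_pos _).le

theorem re_mul_exp_div (t W β : ℂ) :
    (t * (exp W / β)).re =
      ‖t‖ / ‖β‖ * (Real.exp W.re * Real.cos (W.im + (arg t - arg β))) := by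
  have h : t * (exp W / β) = ((‖t‖ / ‖β‖ : ℝ) : ℂ) * exp (W + ((arg t - arg β : ℝ) : ℂ) * I) := by
    conv_lhs => rw [← norm_mul_exp_arg_mul_I t, ← norm_mul_exp_arg_mul_I β]
    push_cast
    rw [sub_mul, exp_add, exp_sub]
    ring
  rw [h, Complex.re_ofReal_mul, exp_re]
  simp

theorem kappaR_eq {q : ℂ} {r : ℝ} (hγ : 0 < gammaR q r) (hβ : (1 + r * q : ℂ) ≠ 0)
    (harg : |arg (1 + r * q)| < Real.pi * gammaR q r / 2) :
    0 < Real.cos (arg (1 + r * q) / gammaR q r) ∧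
    kappaR q r = ‖(1 + r * q : ℂ)‖⁻¹ * (Real.cos (arg (1 + r * q) / gammaR q r) ^ gammaR q r *
      (1 / 2) ^ (1 - gammaR q r)) := by
  unfold kappaR
  set β : ℂ := 1 + r * q
  set γ := gammaR q r
  have hn : 0 < ‖β‖ := norm_pos_iff.2 hβ
  have hcos : 0 < Real.cos (arg β / γ) := by
    refine Real.cos_pos_of_mem_Ioo (abs_lt.1 ?_)
    rw [abs_div, abs_of_pos hγ, div_lt_iff₀ hγ]
    linarith
  have hre : ((β ^ (((1 / γ : ℝ)) : ℂ) : ℂ).re) = ‖β‖ ^ (1 / γ) * Real.cos (arg β / γ) := by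
    rw [Complex.cpow_ofReal_re, mul_one_div]
  refine ⟨hcos, ?_⟩
  rw [hre, Real.mul_rpow (by positivity) hcos.le, ← Real.rpow_mul hn.le, one_div_mul_cancel hγ.ne',
    Real.rpow_one, Real.div_rpow zero_le_one zero_le_two, Real.one_rpow]
  have : (0 : ℝ) < 2 ^ (1 - γ) := by positivity
  field_simp

/-- With `W = (1 - γ) V` and `|V| ≤ 1/2`, the angle `Im W - arg β` is the convex combination of
`-arg β / γ` and `Im V` with weights `γ` and `1 - γ`. The cosine thus splits into a factor depending
on `β` alone and one that combines with `exp (Re W)` into `(exp (Re V) cos (Im V)) ^ (1 - γ)`. -/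
theorem kappaR_le_re {q : ℂ} {r : ℝ} (hγ0 : 0 < gammaR q r) (hγ1 : gammaR q r < 1)
    (hβ : (1 + r * q : ℂ) ≠ 0) (harg : |arg (1 + r * q)| < Real.pi * gammaR q r / 2)
    {W : ℂ} (hW : ‖W‖ ≤ (1 - gammaR q r) / 2) :
    kappaR q r ≤ (exp W / (1 + r * q)).re := by
  obtain ⟨hcos, hκ⟩ := kappaR_eq hγ0 hβ harg
  rw [hκ, ← one_mul (exp W / _), re_mul_exp_div, norm_one, arg_one,
    one_div ‖(1 + r * q : ℂ)‖, zero_sub]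
  set β : ℂ := 1 + r * q
  set γ := gammaR q r
  have hc : 0 < 1 - γ := sub_pos.2 hγ1
  set V : ℂ := ((1 - γ : ℝ) : ℂ)⁻¹ * W with hV
  have hWV : W = ((1 - γ : ℝ) : ℂ) * V := by
    rw [hV, mul_inv_cancel_left₀ (by exact_mod_cast hc.ne')]
  have hVn : ‖V‖ ≤ 1 / 2 := by
    rw [hV, norm_mul, norm_inv, Complex.norm_real, Real.norm_eq_abs, abs_of_pos hc,
      inv_mul_le_iff₀ hc]
    linarith
  have hVim : |V.im| ≤ Real.pi / 2 := by
    have := abs_im_le_norm V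
    linarith [Real.pi_gt_three]
  have hVcos : 0 ≤ Real.cos V.im := Real.cos_nonneg_of_mem_Icc (abs_le.1 hVim)
  have hre : W.re = V.re * (1 - γ) := by rw [hWV, Complex.re_ofReal_mul, mul_comm]
  have him : W.im = (1 - γ) * V.im := by rw [hWV, Complex.im_ofReal_mul]
  refine mul_le_mul_of_nonneg_left ?_ (inv_nonneg.2 (norm_nonneg β))
  have harg' : |-(arg β / γ)| ≤ Real.pi / 2 := by
    rw [abs_neg, abs_div, abs_of_pos hγ0, div_le_iff₀ hγ0]
    linarith
  have hconc := cos_rpow_mul_cos_rpow_le hγ0.le hγ1.le harg' hVim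
  rw [Real.cos_neg] at hconc
  have e : γ * -(arg β / γ) + (1 - γ) * V.im = W.im + -arg β := by
    rw [him]; field_simp; ring
  rw [e] at hconc
  calc Real.cos (arg β / γ) ^ γ * (1 / 2) ^ (1 - γ)
      ≤ Real.cos (arg β / γ) ^ γ * (Real.exp V.re * Real.cos V.im) ^ (1 - γ) := by
        gcongr
        exact half_le_exp_re_mul_cos_im hVn
    _ = Real.exp W.re * (Real.cos (arg β / γ) ^ γ * Real.cos V.im ^ (1 - γ)) := by
        rw [Real.mul_rpow (Real.exp_pos _).le hVcos, ← Real.exp_mul, hre]; ring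
    _ ≤ _ := mul_le_mul_of_nonneg_left hconc (Real.exp_pos _).le

/-- Uniform positivity in the sector of half-opening `π γ / 2`. -/
theorem exists_pos_lt_re_of_mem_sector {β t : ℂ} {γ : ℝ} (hγ0 : 0 < γ) (hγ1 : γ < 1) (hβ : β ≠ 0)
    (ht : t ∈ sector (arg β) (Real.pi * γ / 2)) :
    ∃ ε : ℝ, 0 < ε ∧ ∀ W : ℂ, ‖W‖ ≤ (1 - γ) / 2 → ε ≤ (t * (exp W / β)).re := by
  obtain ⟨ht0, hta⟩ := ht
  -- Since `|Im W| ≤ (1 - γ) / 2`, this keeps the total angle uniformly below `π / 2`.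
  have hγπ : (1 - γ) / 2 ≤ Real.pi / 2 - Real.pi * γ / 2 := by
    nlinarith [Real.pi_gt_three]
  set θ := |arg t - arg β| + (1 - γ) / 2 with hθ
  have hθ0 : 0 ≤ θ := add_nonneg (abs_nonneg _) (by linarith)
  have hθ1 : θ < Real.pi / 2 := by linarith
  have hcos : 0 < Real.cos θ :=
    Real.cos_pos_of_mem_Ioo ⟨by linarith [Real.pi_pos], hθ1⟩
  have hn : 0 < ‖t‖ / ‖β‖ := div_pos (norm_pos_iff.2 ht0) (norm_pos_iff.2 hβ)
  refine ⟨‖t‖ / ‖β‖ * (Real.exp (-((1 - γ) / 2)) * Real.cos θ), by positivity, fun W hW => ?_⟩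
  rw [re_mul_exp_div]
  have h1 : -((1 - γ) / 2) ≤ W.re := by
    linarith [(abs_le.1 ((abs_re_le_norm W).trans hW)).1]
  have h2 : |W.im + (arg t - arg β)| ≤ θ := by
    refine (abs_add_le _ _).trans ?_
    linarith [(abs_im_le_norm W).trans hW]
  have h3 : Real.cos θ ≤ Real.cos (W.im + (arg t - arg β)) := by
    rw [← Real.cos_abs (W.im + _)]
    exact Real.cos_le_cos_of_nonneg_of_le_pi (abs_nonneg _) (by linarith [Real.pi_pos]) h2
  gcongr

/-! ### The semigroup generated by the resolvent -/

theorem re_conj_mul_mul (w g : ℂ) : (conj w * (w * g)).re = g.re * ‖w‖ ^ 2 := by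
  rw [← mul_assoc, mul_comm (conj w), mul_conj, Complex.re_ofReal_mul, normSq_eq_norm_sq, mul_comm]

/-- The parameters `t` for which `t * g` has real part bounded below by a positive number on the
disk. -/
def strictlyDissipativeSet (g : ℂ → ℂ) : Set ℂ :=
  {t | ∃ ε : ℝ, 0 < ε ∧ ∀ z ∈ unitDisk, ε ≤ (t * g z).re}

theorem convex_strictlyDissipativeSet (g : ℂ → ℂ) : Convex ℝ (strictlyDissipativeSet g) := by
  rintro t ⟨ε, hε, ht⟩ t' ⟨ε', hε', ht'⟩ a b ha hb hab
  have hm : 0 < min ε ε' := lt_min hε hε'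
  refine ⟨min ε ε', hm, fun z hz => ?_⟩
  rw [real_smul, real_smul, add_mul, mul_assoc, mul_assoc, add_re, Complex.re_ofReal_mul,
    Complex.re_ofReal_mul]
  have h1 := mul_le_mul_of_nonneg_left ((min_le_left ε ε').trans (ht z hz)) ha
  have h2 := mul_le_mul_of_nonneg_left ((min_le_right ε ε').trans (ht' z hz)) hb
  calc min ε ε' = a * min ε ε' + b * min ε ε' := by rw [← add_mul, hab, one_mul]
    _ ≤ _ := add_le_add h1 h2

/-- Boundedness of `g` lets half of the margin `ε` absorb a small change of `t`, uniformly in `z`.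
-/
theorem isOpen_strictlyDissipativeSet {g : ℂ → ℂ} {B : ℝ} (hB : ∀ z ∈ unitDisk, ‖g z‖ ≤ B) :
    IsOpen (strictlyDissipativeSet g) := by
  have hB0 : 0 ≤ B := (norm_nonneg _).trans (hB 0 (mem_unitDisk.2 (by simp)))
  rw [Metric.isOpen_iff]
  rintro t ⟨ε, hε, ht⟩
  refine ⟨ε / (2 * (B + 1)), by positivity, fun t' ht' => ⟨ε / 2, half_pos hε, fun z hz => ?_⟩⟩
  rw [Metric.mem_ball, dist_eq_norm, lt_div_iff₀ (by positivity)] at ht'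
  have h1 : ‖(t' - t) * g z‖ ≤ ε / 2 := by
    rw [norm_mul]
    nlinarith [mul_le_mul_of_nonneg_left (hB z hz) (norm_nonneg (t' - t)), norm_nonneg (t' - t)]
  have h2 : (t' * g z).re = (t * g z).re + ((t' - t) * g z).re := by
    rw [← add_re]; ring_nf
  have h3 := (abs_le.1 ((abs_re_le_norm _).trans h1)).1
  linarith [ht z hz]

/-- If `f z = z * g z`, the flow lines of `f` extend holomorphically to complex times `t` for which
`t * g` is strictly dissipative. -/
theorem IsFlowLine.exists_holomorphic_extension {f g : ℂ → ℂ}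
    (hf : DifferentiableOn ℂ f unitDisk) (hfg : ∀ z ∈ unitDisk, f z = z * g z)
    (hopen : IsOpen (strictlyDissipativeSet g)) {z : ℂ} (hz : z ∈ unitDisk) {u : ℝ → ℂ}
    (hu : IsFlowLine f z u) :
    ∃ U : ℂ → ℂ, DifferentiableOn ℂ U (strictlyDissipativeSet g) ∧
      MapsTo U (strictlyDissipativeSet g) unitDisk ∧
      ∀ t : ℝ, 0 < t → (t : ℂ) ∈ strictlyDissipativeSet g → U t = u t := by
  have hre : ∀ t ∈ strictlyDissipativeSet g, ∀ w ∈ unitDisk, 0 ≤ (conj w * (t * f w)).re := by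
    rintro t ⟨ε, hε, ht⟩ w hw
    rw [hfg w hw, mul_left_comm t, re_conj_mul_mul]
    exact mul_nonneg (hε.le.trans (ht w hw)) (sq_nonneg _)
  have hex : ∀ t, ∃ v, t ∈ strictlyDissipativeSet g → IsFlowLine (fun w => t * f w) z v := by
    intro t
    by_cases ht : t ∈ strictlyDissipativeSet g
    · obtain ⟨v, hv⟩ := exists_isFlowLine (hf.const_mul t) (hre t ht) hz
      exact ⟨v, fun _ => hv⟩
    · exact ⟨0, fun h => absurd h ht⟩
  choose v hv using hex
  refine ⟨fun t => v t 1, fun t ht => ?_, fun t ht => ((hv t ht).2 1 zero_le_one).1,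
    fun t ht htW => ?_⟩
  · refine (hasDerivAt_flow_of_parameter hf hz ?_).differentiableAt.differentiableWithinAt
    filter_upwards [hopen.mem_nhds ht] with t' ht'
    refine ⟨hv t' ht', fun σ hσ => ?_⟩
    simpa using (hv t' ht').norm_le (κ := 0) (by simpa using hre t' ht') hσ
  -- For real `t`, rescaling time and uniqueness identify the time-one value with `u t`.
  · have hscaled : IsFlowLine (fun w => (t : ℂ) * f w) z (fun σ => u (t * σ)) := by
      refine ⟨by simpa using hu.1, fun σ hσ => ?_⟩
      have hσt : 0 ≤ t * σ := mul_nonneg ht.le hσ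
      refine ⟨(hu.2 _ hσt).1, ?_⟩
      have h1 : HasDerivWithinAt (fun σ : ℝ => t * σ) t (Ici 0) σ := by
        simpa using ((hasDerivAt_id σ).const_mul t).hasDerivWithinAt
      have h2 := (hu.2 _ hσt).2.scomp σ h1 (fun x hx => mul_nonneg ht.le hx)
      simpa [Function.comp_def] using h2
    simpa using (hv t htW).eqOn (hf.const_mul (t : ℂ)) hscaled (mem_Ici.2 zero_le_one)

theorem mainTheorem4 (q : ℂ) (hq : 0 < q.re) (r : ℝ) (hr : 6 / q.re ≤ r)
    (G : ℂ → ℂ) (hG : G ∈ resolventFamily q r) :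
    IsGenerator G ∧
    ∀ u : ℝ → ℂ → ℂ, IsSemigroupGeneratedBy G u →
      (TendstoUniformlyOn u (fun _ => 0) atTop unitDisk ∧
        (|arg (1 + r * q)| < Real.pi * gammaR q r / 2 →
          IsSqueezingCoefficient u (kappaR q r))) ∧
      (∀ z ∈ unitDisk, ExtendsAnalyticallyTo (fun t => u t z)
        (sector (arg (1 + r * q)) (Real.pi * gammaR q r / 2))) := by
  have hs : 6 ≤ r * q.re := (div_le_iff₀ hq).1 hr
  obtain ⟨hγ0, hγ1, -⟩ := gammaR_bounds hs
  have hβ : (1 + r * q : ℂ) ≠ 0 := by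
    intro h
    have := congrArg Complex.re h
    simp only [add_re, one_re, Complex.re_ofReal_mul, zero_re] at this
    linarith
  have hGd : DifferentiableOn ℂ G unitDisk := hG.1
  have hrep : ∀ z, ∃ W : ℂ, z ∈ unitDisk → ‖W‖ ≤ (1 - gammaR q r) / 2 ∧
      G z = z * (exp W / (1 + r * q)) ∧
      ‖exp W / (1 + r * q)‖ ^ 2 ≤ (exp W / (1 + r * q)).re := by
    intro z
    by_cases hz : z ∈ unitDisk
    · obtain ⟨W, hW⟩ := resolvent_representation hs hG hz
      exact ⟨W, fun _ => hW⟩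
    · exact ⟨0, fun h => absurd h hz⟩
  choose W hW using hrep
  set g : ℂ → ℂ := fun z => exp (W z) / (1 + r * q) with hg
  have hGg : ∀ z ∈ unitDisk, G z = z * g z := fun z hz => (hW z hz).2.1
  -- `Re g ≥ |g|²` and `|g| = exp (Re W) / |β|` with `Re W ≥ -1/2`; no condition on `arg β` enters.
  obtain ⟨δ, hδ0, hδ⟩ : ∃ δ : ℝ, 0 < δ ∧ ∀ z ∈ unitDisk, δ ≤ (g z).re := by
    refine ⟨(Real.exp (-(1 / 2)) / ‖(1 + r * q : ℂ)‖) ^ 2,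
      pow_pos (div_pos (Real.exp_pos _) (norm_pos_iff.2 hβ)) 2, fun z hz => ?_⟩
    refine le_trans ?_ (hW z hz).2.2
    rw [norm_div, norm_exp]
    have := (abs_le.1 ((abs_re_le_norm _).trans (hW z hz).1)).1
    gcongr
    linarith
  have hδG : ∀ w ∈ unitDisk, δ * ‖w‖ ^ 2 ≤ (conj w * G w).re := fun w hw => by
    rw [hGg w hw, re_conj_mul_mul]
    exact mul_le_mul_of_nonneg_right (hδ w hw) (sq_nonneg _)
  have hgB : ∀ z ∈ unitDisk, ‖g z‖ ≤ 1 := fun z hz => by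
    have h1 := ((hW z hz).2.2).trans (re_le_norm _)
    have h2 := norm_nonneg (g z)
    by_contra! h
    have : ‖g z‖ ^ 2 ≤ ‖g z‖ := h1
    nlinarith
  refine ⟨⟨hGd, fun z hz => ?_⟩, fun u hu => ⟨⟨?_, fun harg => ?_⟩, fun z hz => ?_⟩⟩
  · obtain ⟨v, hv⟩ := exists_isFlowLine hGd
      (fun w hw => (mul_nonneg hδ0.le (sq_nonneg _)).trans (hδG w hw)) hz
    exact ⟨v, hv, fun w hw => hw.eqOn hGd hv⟩
  · rw [Metric.tendstoUniformlyOn_iff]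
    intro ε hε
    have hlim : Tendsto (fun t => Real.exp (-δ * t)) atTop (𝓝 0) :=
      Real.tendsto_exp_atBot.comp (tendsto_id.const_mul_atTop_of_neg (neg_lt_zero.2 hδ0))
    filter_upwards [hlim.eventually_lt_const hε, eventually_ge_atTop 0] with t ht ht0 z hz
    rw [dist_zero_left]
    calc ‖u t z‖ ≤ ‖z‖ * Real.exp (-δ * t) := (hu z hz).norm_le hδG ht0
      _ ≤ Real.exp (-δ * t) :=
        mul_le_of_le_one_left (Real.exp_pos _).le (mem_unitDisk.1 hz).le
      _ < ε := ht
  · obtain ⟨hcos, hκ⟩ := kappaR_eq hγ0 hβ harg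
    refine ⟨?_, fun t ht z hz => (hu z hz).norm_le (fun w hw => ?_) ht.le⟩
    · rw [hκ]
      have := norm_pos_iff.2 hβ
      positivity
    · rw [hGg w hw, re_conj_mul_mul]
      exact mul_le_mul_of_nonneg_right (kappaR_le_re hγ0 hγ1 hβ harg (hW w hw).1) (sq_nonneg _)
  · have hopen := isOpen_strictlyDissipativeSet hgB
    have hpos : ∀ t : ℝ, 0 < t → (t : ℂ) ∈ strictlyDissipativeSet g := fun t ht =>
      ⟨t * δ, mul_pos ht hδ0, fun z hz => by
        rw [Complex.re_ofReal_mul]; exact mul_le_mul_of_nonneg_left (hδ z hz) ht.le⟩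
    obtain ⟨U, hUd, hUm, hUu⟩ := (hu z hz).exists_holomorphic_extension hGd hGg hopen hz
    refine ⟨strictlyDissipativeSet g, hopen, convex_strictlyDissipativeSet g, fun t ht => ?_, hpos,
      U, hUd, hUm, fun t ht => hUu t ht (hpos t ht)⟩
    obtain ⟨ε, hε, h⟩ := exists_pos_lt_re_of_mem_sector hγ0 hγ1 hβ ht
    exact ⟨ε, hε, fun z hz => h _ (hW z hz).1⟩
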